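/- For $n\ge 1$ let $S_n$ be the group of permutations of $\{1,\dots,n\}$, multiplied as maps (the right factor acts first), with identity $e$, and let $s_i=(i,i+1)$, $1\le i\le n-1$. An expression of $\pi\in S_n$ is a word in the $s_i$ whose product is $\pi$; it is reduced if its number of letters is the minimum $\ell(\pi)$. Let $D_R(\pi)=\{s_i : \ell(\pi s_i)<\ell(\pi)\}$. The Bruhat order is defined by: $u\le v$ if and only if every reduced expression of $v$ has a (not necessarily contiguous) subword that is a reduced expression of $u$. The $\widetilde R$-polynomials of $S_n$ are the unique polynomials $\widetilde R_{u,v}(q)\in\mathbb Z[q]$, $u,v\in S_n$, such that $\widetilde R_{u,v}=0$ if $u\not\le v$, $\widetilde R_{v,v}=1$, and, for $u\le v$ and $s\in D_R(v)$, $$\widetilde R_{u,v}(q)=\begin{cases}\widetilde R_{us,vs}(q), & s\in D_R(u),\\ \widetilde R_{us,vs}(q)+q\,\widetilde R_{u,vs}(q), & s\notin D_R(u).\end{cases}$$ For $n\ge 2$ let $v_n=3\,4\cdots n\,1\,2\in S_n$ in one-line notation (so $v_2=e$), and for $n\ge 3$ let $\Omega_n=s_2s_1s_3s_2\cdots s_{n-1}s_{n-2}$,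 a word of $2(n-2)$ letters. For a word $\omega=s_{i_1}s_{i_2}\cdots s_{i_k}$ put $\ell(\omega)=k$, let $d(\omega)$ be the number of indices $1\le t<k$ with $i_t-i_{t+1}=1$, and let $h(\omega)=n-\ell(\omega)+d(\omega)$. **Theorem.** Let $n\ge 3$, let $\sigma\in S_n$ with $\sigma\le v_n$ in the Bruhat order, and let $\omega$ be any reduced expression of $\sigma$ that is a subword of $\Omega_n$. Then $\ell(\omega)-2d(\omega)\ge 0$, $h(\omega)\ge 2$, and $$\widetilde R_{\sigma,v_n}(q)=q^{\ell(\omega)-2d(\omega)}\,\widetilde R_{e,v_{h(\omega)}}(q),$$ where the polynomial on the right is taken in $S_{h(\omega)}$. -/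

import Mathlib

namespace RTilde

open Polynomial

/-! Permutations of `{1, …, n}` are modelled by `Equiv.Perm (Fin n)`, the element `k` being
`⟨k - 1, _⟩`.  Products are compositions of maps (the right factor acts first), so that right
multiplication by `s_i` exchanges the entries in positions `i` and `i + 1` of the one-line
notation. -/

/-- The simple transposition `s_i = (i, i + 1)` of `S_n`, for `1 ≤ i ≤ n - 1`
(the value for other `i` is irrelevant: such letters are not allowed in expressions). -/
def s (n i : ℕ) : Equiv.Perm (Fin n) :=
  if h : 1 ≤ i ∧ i < n then Equiv.swap ⟨i - 1, by omega⟩ ⟨i, h.2⟩ else 1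

/-- The word `w = i_1 i_2 ⋯ i_k` is an expression of `π`: all letters lie in `{1, …, n - 1}` and
`π = s_{i_1} s_{i_2} ⋯ s_{i_k}`. -/
def IsExpr (n : ℕ) (w : List ℕ) (π : Equiv.Perm (Fin n)) : Prop :=
  (∀ i ∈ w, 1 ≤ i ∧ i < n) ∧ (w.map (s n)).prod = π

/-- The length `ℓ(π)`: the minimal number of simple transpositions in an expression of `π`. -/
noncomputable def len (n : ℕ) (π : Equiv.Perm (Fin n)) : ℕ :=
  sInf {k | ∃ w, IsExpr n w π ∧ w.length = k}

/-- `w` is a reduced expression of `π`. -/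
def IsReducedExpr (n : ℕ) (w : List ℕ) (π : Equiv.Perm (Fin n)) : Prop :=
  IsExpr n w π ∧ w.length = len n π

/-- `s_i` is a right descent of `π`, i.e. `s_i ∈ D_R(π)`. -/
def IsRightDescent (n : ℕ) (π : Equiv.Perm (Fin n)) (i : ℕ) : Prop :=
  (1 ≤ i ∧ i < n) ∧ len n (π * s n i) < len n π

/-- The Bruhat order: `u ≤ v` iff every reduced expression of `v` has a subword that is a reduced
expression of `u`. -/
def BruhatLE (n : ℕ) (u v : Equiv.Perm (Fin n)) : Prop :=
  ∀ w, IsReducedExpr n w v → ∃ w', w'.Sublist w ∧ IsReducedExpr n w' u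

/-- The properties that recursively determine the family of `R̃`-polynomials of `S_n`. -/
structure IsRTildeFamily (n : ℕ) (R : Equiv.Perm (Fin n) → Equiv.Perm (Fin n) → ℤ[X]) : Prop where
  /-- `R̃_{u,v} = 0` if `u ≰ v` -/
  eq_zero : ∀ u v, ¬ BruhatLE n u v → R u v = 0
  /-- `R̃_{v,v} = 1` -/
  self : ∀ v, R v v = 1
  /-- `R̃_{u,v} = R̃_{us,vs}` if `u ≤ v`, `s ∈ D_R(v)` and `s ∈ D_R(u)` -/
  of_descent : ∀ u v i, BruhatLE n u v → IsRightDescent n v i → IsRightDescent n u i →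
    R u v = R (u * s n i) (v * s n i)
  /-- `R̃_{u,v} = R̃_{us,vs} + q R̃_{u,vs}` if `u ≤ v`, `s ∈ D_R(v)` and `s ∉ D_R(u)` -/
  of_not_descent : ∀ u v i, BruhatLE n u v → IsRightDescent n v i → ¬ IsRightDescent n u i →
    R u v = R (u * s n i) (v * s n i) + X * R u (v * s n i)

/-! The rest of this part shows that there is exactly one such family. -/

/-- Descent of the one-line notation at position `i`. -/
def Dc {n : ℕ} (u : Equiv.Perm (Fin n)) (i : ℕ) : Prop :=
  ∃ h : 1 ≤ i ∧ i < n, u ⟨i, h.2⟩ < u ⟨i - 1, by omega⟩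

theorem s_mul_self (n i : ℕ) : s n i * s n i = 1 := by
  unfold s; split_ifs <;> simp

theorem s_inv (n i : ℕ) : (s n i)⁻¹ = s n i := by
  rw [inv_eq_iff_mul_eq_one, s_mul_self]

theorem mul_s_mul_s {n : ℕ} (u : Equiv.Perm (Fin n)) (i : ℕ) : u * s n i * s n i = u := by
  rw [mul_assoc, s_mul_self, mul_one]

theorem s_mul_s_mul {n : ℕ} (u : Equiv.Perm (Fin n)) (i : ℕ) : s n i * (s n i * u) = u := by
  rw [← mul_assoc, s_mul_self, one_mul]

theorem Dc_mul_s {n : ℕ} (u : Equiv.Perm (Fin n)) {i : ℕ} (hi : 1 ≤ i ∧ i < n) :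
    Dc (u * s n i) i ↔ ¬ Dc u i := by
  have hne : u ⟨i, hi.2⟩ ≠ u ⟨i - 1, by omega⟩ := by
    intro h
    have := u.injective h
    simp at this
    omega
  constructor
  · rintro ⟨_, h⟩ ⟨_, h'⟩
    simp [s, hi] at h
    exact lt_asymm h h'
  · intro h
    refine ⟨hi, ?_⟩
    simp [s, hi]
    rcases lt_or_gt_of_ne hne with h' | h'
    · exact absurd ⟨hi, h'⟩ h
    · exact h'

theorem not_Dc_one {n : ℕ} (i : ℕ) : ¬ Dc (1 : Equiv.Perm (Fin n)) i := by
  rintro ⟨h, h'⟩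
  simp at h'
  omega

/-- Left multiplication by `s_j` changes a descent only if it is a right multiplication. -/
theorem s_mul_eq {n : ℕ} (u : Equiv.Perm (Fin n)) {i j : ℕ}
    (h : ¬ (Dc (s n j * u) i ↔ Dc u i)) : s n j * u = u * s n i := by
  by_cases hi : 1 ≤ i ∧ i < n
  swap
  · exact absurd ⟨fun ⟨h, _⟩ => absurd h hi, fun ⟨h, _⟩ => absurd h hi⟩ h
  by_cases hj : 1 ≤ j ∧ j < n
  swap
  · simp [s, hj] at h
  have hsi : s n i = Equiv.swap ⟨i - 1, by omega⟩ ⟨i, hi.2⟩ := by simp [s, hi]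
  have hsj : s n j = Equiv.swap ⟨j - 1, by omega⟩ ⟨j, hj.2⟩ := by simp [s, hj]
  have hne : u ⟨i, hi.2⟩ ≠ u ⟨i - 1, by omega⟩ := by
    intro h
    have := u.injective h
    simp at this
    omega
  have h2 : ¬ (s n j (u ⟨i, hi.2⟩) < s n j (u ⟨i - 1, by omega⟩) ↔
      u ⟨i, hi.2⟩ < u ⟨i - 1, by omega⟩) := by
    intro h3
    apply h
    constructor
    · rintro ⟨_, h4⟩; exact ⟨hi, h3.1 h4⟩
    · rintro ⟨_, h4⟩; exact ⟨hi, h3.2 h4⟩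
  rw [hsi, Equiv.mul_swap_eq_swap_mul]
  congr 1
  rw [hsj] at h2 ⊢
  generalize u ⟨i, hi.2⟩ = q at *
  generalize u ⟨i - 1, by omega⟩ = p at *
  rw [Equiv.swap_apply_def, Equiv.swap_apply_def] at h2
  have key : (p.val = j - 1 ∧ q.val = j) ∨ (p.val = j ∧ q.val = j - 1) := by
    simp only [Fin.ext_iff, Fin.lt_def, ne_eq] at *
    split_ifs at h2 <;> simp at * <;> omega
  rcases key with ⟨h3, h4⟩ | ⟨h3, h4⟩
  · congr 1 <;> exact Fin.ext (by simp [h3, h4])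
  · rw [Equiv.swap_comm]
    congr 1 <;> exact Fin.ext (by simp [h3, h4])

/-- The exchange property. -/
theorem exchange {n i : ℕ} (w : List ℕ) (h : Dc (w.map (s n)).prod i) :
    ∃ w' : List ℕ, w'.Sublist w ∧ w'.length + 1 = w.length ∧
      (w'.map (s n)).prod = (w.map (s n)).prod * s n i := by
  induction w with
  | nil => exact absurd h (by simpa using not_Dc_one i)
  | cons j w ih =>
    by_cases hd : Dc (w.map (s n)).prod i
    · obtain ⟨w', h1, h2, h3⟩ := ih hd
      exact ⟨j :: w', h1.cons_cons j, by simp [h2], by simp [h3, mul_assoc]⟩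
    · refine ⟨w, List.sublist_cons_self j w, by simp, ?_⟩
      rw [List.map_cons, List.prod_cons] at h ⊢
      rw [s_mul_eq (i := i) _ (by tauto), mul_s_mul_s]

theorem exists_expr {n : ℕ} (π : Equiv.Perm (Fin n)) : ∃ w, IsExpr n w π := by
  cases n with
  | zero => exact ⟨[], by simp, Subsingleton.elim _ _⟩
  | succ m =>
    have h : π ∈ (⊤ : Submonoid (Equiv.Perm (Fin (m + 1)))) := trivial
    rw [← Equiv.Perm.mclosure_swap_castSucc_succ] at h
    induction h using Submonoid.closure_induction with
    | mem x hx =>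
      obtain ⟨i, rfl⟩ := hx
      refine ⟨[i + 1], by simp, ?_⟩
      simp [s]
      rfl
    | one => exact ⟨[], by simp, by simp⟩
    | mul x y _ _ hx hy =>
      obtain ⟨a, ha, ha'⟩ := hx
      obtain ⟨b, hb, hb'⟩ := hy
      refine ⟨a ++ b, ?_, by simp [ha', hb']⟩
      intro i hi
      rcases List.mem_append.1 hi with h | h
      · exact ha i h
      · exact hb i h

theorem exists_reduced {n : ℕ} (π : Equiv.Perm (Fin n)) : ∃ w, IsReducedExpr n w π := by
  obtain ⟨w, hw⟩ := exists_expr π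
  obtain ⟨w', h1, h2⟩ := Nat.sInf_mem (s := {k | ∃ w, IsExpr n w π ∧ w.length = k}) ⟨_, w, hw, rfl⟩
  exact ⟨w', h1, h2⟩

theorem len_le {n : ℕ} {w : List ℕ} {π : Equiv.Perm (Fin n)} (h : IsExpr n w π) :
    len n π ≤ w.length := Nat.sInf_le ⟨w, h, rfl⟩

theorem IsExpr.concat {n i : ℕ} {w : List ℕ} {π : Equiv.Perm (Fin n)} (h : IsExpr n w π)
    (hi : 1 ≤ i ∧ i < n) : IsExpr n (w ++ [i]) (π * s n i) := by
  refine ⟨?_, by simp [h.2]⟩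
  intro j hj
  rcases List.mem_append.1 hj with h' | h'
  · exact h.1 j h'
  · simp at h'; subst h'; exact hi

theorem len_of_Dc {n i : ℕ} {π : Equiv.Perm (Fin n)} (h : Dc π i) :
    len n (π * s n i) + 1 = len n π := by
  obtain ⟨w, hw, hl⟩ := exists_reduced π
  have h' := h
  rw [← hw.2] at h'
  obtain ⟨w', h1, h2, h3⟩ := exchange w h'
  have e1 : len n (π * s n i) ≤ w'.length :=
    len_le ⟨fun i hi => hw.1 i (h1.subset hi), by rw [h3, hw.2]⟩
  obtain ⟨x, hx, hl'⟩ := exists_reduced (π * s n i)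
  have e2 := len_le (hx.concat h.1)
  rw [mul_s_mul_s] at e2
  simp at e2
  omega

theorem isRightDescent_iff {n i : ℕ} {π : Equiv.Perm (Fin n)} :
    IsRightDescent n π i ↔ Dc π i := by
  constructor
  · rintro ⟨hi, h⟩
    by_contra hd
    have := len_of_Dc ((Dc_mul_s π hi).2 hd)
    rw [mul_s_mul_s] at this
    omega
  · intro h
    have := len_of_Dc h
    exact ⟨h.1, by omega⟩

/-- A reduced expression with its last letter removed. -/
theorem IsReducedExpr.of_concat {n i : ℕ} {w : List ℕ} {v : Equiv.Perm (Fin n)}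
    (h : IsReducedExpr n (w ++ [i]) v) : Dc v i ∧ IsReducedExpr n w (v * s n i) := by
  have hi : 1 ≤ i ∧ i < n := h.1.1 i (by simp)
  have he : IsExpr n w (v * s n i) := by
    refine ⟨fun j hj => h.1.1 j (by simp [hj]), ?_⟩
    rw [← h.1.2]; simp [mul_assoc, s_mul_self]
  have hl := len_le he
  have h2 := h.2
  simp at h2
  have hd : Dc v i := isRightDescent_iff.1 ⟨hi, by omega⟩
  have := len_of_Dc hd
  exact ⟨hd, he, by omega⟩

theorem IsReducedExpr.concat {n i : ℕ} {w : List ℕ} {v : Equiv.Perm (Fin n)}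
    (h : IsReducedExpr n w (v * s n i)) (hd : Dc v i) : IsReducedExpr n (w ++ [i]) v := by
  have := len_of_Dc hd
  refine ⟨?_, by simp [h.2, this]⟩
  simpa [mul_s_mul_s] using h.1.concat hd.1

theorem prod_reverse (n : ℕ) (w : List ℕ) :
    (w.reverse.map (s n)).prod = ((w.map (s n)).prod)⁻¹ := by
  induction w with
  | nil => simp
  | cons a l ih =>
    rw [List.reverse_cons, List.map_append, List.prod_append, ih]
    simp [s_inv]

theorem IsExpr.reverse {n : ℕ} {w : List ℕ} {v : Equiv.Perm (Fin n)} (h : IsExpr n w v) :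
    IsExpr n w.reverse v⁻¹ :=
  ⟨fun i hi => h.1 i (by simpa using hi), by rw [prod_reverse, h.2]⟩

theorem IsReducedExpr.reverse {n : ℕ} {w : List ℕ} {v : Equiv.Perm (Fin n)}
    (h : IsReducedExpr n w v) : IsReducedExpr n w.reverse v⁻¹ := by
  refine ⟨h.1.reverse, ?_⟩
  obtain ⟨x, hx, hl⟩ := exists_reduced v⁻¹
  have h1 := len_le h.1.reverse
  have h2 := len_le hx.reverse
  rw [inv_inv] at h2
  have := h.2
  simp at *
  omega

open Classical in
/-- The operator `f ↦ (u ↦ f(us) + [us > u] q f(u))`. -/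
noncomputable def opR (n i : ℕ) (f : Equiv.Perm (Fin n) → ℤ[X]) : Equiv.Perm (Fin n) → ℤ[X] :=
  fun u => f (u * s n i) + if Dc u i then 0 else X * f u

open Classical in
/-- The inverse of `opR`. -/
noncomputable def opT (n i : ℕ) (f : Equiv.Perm (Fin n) → ℤ[X]) : Equiv.Perm (Fin n) → ℤ[X] :=
  fun u => f (u * s n i) - if Dc u i then X * f u else 0

open Classical in
/-- The left-handed version of `opT`. -/
noncomputable def opL (n j : ℕ) (f : Equiv.Perm (Fin n) → ℤ[X]) : Equiv.Perm (Fin n) → ℤ[X] :=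
  fun u => f (s n j * u) - if Dc u⁻¹ j then X * f u else 0

open Classical in
/-- The indicator function of `x`. -/
noncomputable def dl {n : ℕ} (x : Equiv.Perm (Fin n)) : Equiv.Perm (Fin n) → ℤ[X] :=
  fun u => if u = x then 1 else 0

theorem opR_opT {n i : ℕ} (hi : 1 ≤ i ∧ i < n) (f : Equiv.Perm (Fin n) → ℤ[X]) :
    opR n i (opT n i f) = f := by
  funext u
  by_cases h : Dc u i <;> simp [opR, opT, Dc_mul_s u hi, h, mul_s_mul_s]

theorem opT_opR {n i : ℕ} (hi : 1 ≤ i ∧ i < n) (f : Equiv.Perm (Fin n) → ℤ[X]) :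
    opT n i (opR n i f) = f := by
  funext u
  by_cases h : Dc u i <;> simp [opR, opT, Dc_mul_s u hi, h, mul_s_mul_s]

theorem opT_opL {n i j : ℕ} (hi : 1 ≤ i ∧ i < n) (hj : 1 ≤ j ∧ j < n)
    (f : Equiv.Perm (Fin n) → ℤ[X]) : opT n i (opL n j f) = opL n j (opT n i f) := by
  funext u
  have e1 : (u * s n i)⁻¹ = s n i * u⁻¹ := by rw [mul_inv_rev, s_inv]
  by_cases h : s n j * u = u * s n i
  · have h' : s n i * u⁻¹ = u⁻¹ * s n j := by
      have := congrArg (·⁻¹) h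
      simpa [s_inv] using this.symm
    have hD : Dc u i ↔ Dc u⁻¹ j := by
      have hsi : s n i = Equiv.swap ⟨i - 1, by omega⟩ ⟨i, hi.2⟩ := by simp [s, hi]
      have hsj : s n j = Equiv.swap ⟨j - 1, by omega⟩ ⟨j, hj.2⟩ := by simp [s, hj]
      have a1 := DFunLike.congr_fun h ⟨i, hi.2⟩
      have hne : u ⟨i, hi.2⟩ ≠ u ⟨i - 1, by omega⟩ := by
        intro h
        have := u.injective h
        simp at this
        omega
      simp [hsi, hsj] at a1
      rw [Equiv.swap_apply_def] at a1
      split_ifs at a1 with c1 c2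
      · have c1' : u⁻¹ ⟨j - 1, by omega⟩ = ⟨i, hi.2⟩ := by rw [Equiv.Perm.inv_eq_iff_eq, c1]
        have c2' : u⁻¹ ⟨j, hj.2⟩ = ⟨i - 1, by omega⟩ := by rw [Equiv.Perm.inv_eq_iff_eq, a1]
        have d1 : Dc u i := ⟨hi, by rw [c1, ← a1, Fin.lt_def]; simp; omega⟩
        have d2 : Dc u⁻¹ j := ⟨hj, by rw [c1', c2', Fin.lt_def]; simp; omega⟩
        tauto
      · have c1' : u⁻¹ ⟨j - 1, by omega⟩ = ⟨i - 1, by omega⟩ := by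
          rw [Equiv.Perm.inv_eq_iff_eq, a1]
        have c2' : u⁻¹ ⟨j, hj.2⟩ = ⟨i, hi.2⟩ := by rw [Equiv.Perm.inv_eq_iff_eq, c2]
        have d1 : ¬ Dc u i := by
          rintro ⟨_, h⟩
          rw [c2, ← a1, Fin.lt_def] at h; simp at h; omega
        have d2 : ¬ Dc u⁻¹ j := by
          rintro ⟨_, h⟩
          rw [c1', c2', Fin.lt_def] at h; simp at h; omega
        tauto
      · exact absurd a1 hne
    by_cases hd : Dc u i
    · have hd' := hD.1 hd
      have x1 : ¬ Dc (u * s n i) i := by rw [Dc_mul_s u hi]; tauto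
      have x2 : ¬ Dc (u⁻¹ * s n j) j := by rw [Dc_mul_s u⁻¹ hj]; tauto
      simp [opT, opL, e1, h', h, hd, hd', x1, x2, mul_s_mul_s, ← mul_assoc]
    · have hd' : ¬ Dc u⁻¹ j := fun x => hd (hD.2 x)
      have x1 : Dc (u * s n i) i := by rw [Dc_mul_s u hi]; tauto
      have x2 : Dc (u⁻¹ * s n j) j := by rw [Dc_mul_s u⁻¹ hj]; tauto
      simp [opT, opL, e1, h', h, hd, hd', x1, x2, mul_s_mul_s, ← mul_assoc]
  · have h' : s n i * u⁻¹ ≠ u⁻¹ * s n j := by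
      intro h'
      have := congrArg (·⁻¹) h'
      apply h
      simpa [s_inv] using this.symm
    have y1 : Dc (s n j * u) i ↔ Dc u i := by
      by_contra hc; exact h (s_mul_eq u hc)
    have y2 : Dc (s n i * u⁻¹) j ↔ Dc u⁻¹ j := by
      by_contra hc; exact h' (s_mul_eq _ hc)
    by_cases a : Dc u i <;> by_cases b : Dc u⁻¹ j <;>
      simp [opT, opL, e1, y1, y2, a, b, mul_assoc] <;> ring

theorem opT_dl {n i : ℕ} {x : Equiv.Perm (Fin n)} (hx : ¬ Dc x i) :
    opT n i (dl x) = dl (x * s n i) := by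
  funext u
  have e : u * s n i = x ↔ u = x * s n i := by
    constructor
    · rintro rfl; rw [mul_s_mul_s]
    · rintro rfl; rw [mul_s_mul_s]
  by_cases h : u = x
  · subst h; simp [opT, dl, hx, e]
  · simp [opT, dl, h, e]

theorem opL_dl {n j : ℕ} {x : Equiv.Perm (Fin n)} (hx : ¬ Dc x⁻¹ j) :
    opL n j (dl x) = dl (s n j * x) := by
  funext u
  have e : s n j * u = x ↔ u = s n j * x := by
    constructor
    · rintro rfl; rw [s_mul_s_mul]
    · rintro rfl; rw [s_mul_s_mul]
  by_cases h : u = x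
  · subst h; simp [opL, dl, hx, e]
  · simp [opL, dl, h, e]

/-- Successive application of the operators along a word, first letter first. -/
noncomputable def fR (n : ℕ) (w : List ℕ) (f : Equiv.Perm (Fin n) → ℤ[X]) :
    Equiv.Perm (Fin n) → ℤ[X] := w.foldl (fun g i => opR n i g) f

/-- The same for `opT`. -/
noncomputable def fT (n : ℕ) (w : List ℕ) (f : Equiv.Perm (Fin n) → ℤ[X]) :
    Equiv.Perm (Fin n) → ℤ[X] := w.foldl (fun g i => opT n i g) f

/-- The same for `opL`. -/
noncomputable def fL (n : ℕ) (w : List ℕ) (f : Equiv.Perm (Fin n) → ℤ[X]) :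
    Equiv.Perm (Fin n) → ℤ[X] := w.foldl (fun g i => opL n i g) f

theorem fT_dl {n : ℕ} (w : List ℕ) : ∀ {v : Equiv.Perm (Fin n)}, IsReducedExpr n w v →
    fT n w (dl 1) = dl v := by
  induction w using List.reverseRecOn with
  | nil => intro v h; have := h.1.2; simp at this; simp [fT, this]
  | append_singleton w i ih =>
    intro v h
    obtain ⟨hd, h'⟩ := h.of_concat
    have := ih h'
    unfold fT at *
    rw [List.foldl_append, this, List.foldl_cons, List.foldl_nil, opT_dl, mul_s_mul_s]
    rw [Dc_mul_s v hd.1]; tauto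

theorem fL_dl {n : ℕ} (w : List ℕ) : ∀ {v : Equiv.Perm (Fin n)}, IsReducedExpr n w v⁻¹ →
    fL n w (dl 1) = dl v := by
  induction w using List.reverseRecOn with
  | nil => intro v h; have := h.1.2; simp at this; simp [fL, ← this]
  | append_singleton w i ih =>
    intro v h
    obtain ⟨hd, h'⟩ := h.of_concat
    have e : v⁻¹ * s n i = (s n i * v)⁻¹ := by rw [mul_inv_rev, s_inv]
    rw [e] at h'
    have := ih h'
    unfold fL at *
    rw [List.foldl_append, this, List.foldl_cons, List.foldl_nil, opL_dl, s_mul_s_mul]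
    rw [← e, Dc_mul_s _ hd.1]; tauto

theorem fT_opL {n j : ℕ} (hj : 1 ≤ j ∧ j < n) (w : List ℕ) (hw : ∀ i ∈ w, 1 ≤ i ∧ i < n) :
    ∀ f, fT n w (opL n j f) = opL n j (fT n w f) := by
  induction w with
  | nil => intro f; rfl
  | cons i w ih =>
    intro f
    have := ih (fun k hk => hw k (by simp [hk])) (opT n i f)
    unfold fT at *
    rw [List.foldl_cons, List.foldl_cons, opT_opL (hw i (by simp)) hj, this]

theorem fT_fL {n : ℕ} (w : List ℕ) (hw : ∀ i ∈ w, 1 ≤ i ∧ i < n) (x : List ℕ)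
    (hx : ∀ i ∈ x, 1 ≤ i ∧ i < n) : ∀ f, fT n w (fL n x f) = fL n x (fT n w f) := by
  induction x with
  | nil => intro f; rfl
  | cons j x ih =>
    intro f
    have := ih (fun k hk => hx k (by simp [hk])) (opL n j f)
    rw [fT_opL (hx j (by simp)) w hw] at this
    exact this

theorem fT_sum {n : ℕ} (w : List ℕ) : ∀ f : Equiv.Perm (Fin n) → ℤ[X],
    fT n w f = ∑ x, f x • fT n w (dl x) := by
  have hlin : ∃ L : (Equiv.Perm (Fin n) → ℤ[X]) →ₗ[ℤ[X]] (Equiv.Perm (Fin n) → ℤ[X]),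
      ∀ f, L f = fT n w f := by
    induction w with
    | nil => exact ⟨LinearMap.id, fun f => rfl⟩
    | cons i w ih =>
      obtain ⟨L, hL⟩ := ih
      let M : (Equiv.Perm (Fin n) → ℤ[X]) →ₗ[ℤ[X]] (Equiv.Perm (Fin n) → ℤ[X]) :=
        ⟨⟨opT n i, ?_⟩, ?_⟩
      refine ⟨L.comp M, fun f => hL _⟩
      · intro f g; funext u; simp only [opT, Pi.add_apply]; split_ifs <;> ring
      · intro c f; funext u; simp [opT]; split_ifs <;> ring
  obtain ⟨L, hL⟩ := hlin
  intro f
  have hf : f = ∑ x, f x • dl x := by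
    funext u; simp [dl]
  rw [← hL]
  conv_lhs => rw [hf]
  rw [map_sum]
  refine Finset.sum_congr rfl fun x _ => ?_
  rw [map_smul, hL]

theorem fT_eq {n : ℕ} {w w' : List ℕ} {v : Equiv.Perm (Fin n)} (h : IsReducedExpr n w v)
    (h' : IsReducedExpr n w' v) (f : Equiv.Perm (Fin n) → ℤ[X]) : fT n w f = fT n w' f := by
  rw [fT_sum w, fT_sum w']
  refine Finset.sum_congr rfl fun x _ => ?_
  obtain ⟨y, hy⟩ := exists_reduced x⁻¹
  rw [← fL_dl y hy, fT_fL w h.1.1 y hy.1.1, fT_fL w' h'.1.1 y hy.1.1, fT_dl w h, fT_dl w' h']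

theorem fR_fT {n : ℕ} (w : List ℕ) (hw : ∀ i ∈ w, 1 ≤ i ∧ i < n) :
    ∀ f, fR n w (fT n w.reverse f) = f := by
  induction w with
  | nil => intro f; rfl
  | cons i w ih =>
    intro f
    have := ih (fun k hk => hw k (by simp [hk])) f
    unfold fR fT at *
    rw [List.reverse_cons, List.foldl_append, List.foldl_cons, List.foldl_cons, List.foldl_nil,
      opR_opT (hw i (by simp)), this]

theorem fT_fR {n : ℕ} (w : List ℕ) (hw : ∀ i ∈ w, 1 ≤ i ∧ i < n) :
    ∀ f, fT n w.reverse (fR n w f) = f := by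
  induction w with
  | nil => intro f; rfl
  | cons i w ih =>
    intro f
    have := ih (fun k hk => hw k (by simp [hk])) (opR n i f)
    unfold fR fT at *
    rw [List.reverse_cons, List.foldl_append, List.foldl_cons, List.foldl_cons, List.foldl_nil,
      this, opT_opR (hw i (by simp))]

theorem fR_eq {n : ℕ} {w w' : List ℕ} {v : Equiv.Perm (Fin n)} (h : IsReducedExpr n w v)
    (h' : IsReducedExpr n w' v) (f : Equiv.Perm (Fin n) → ℤ[X]) : fR n w f = fR n w' f := by
  have e := fT_fR w h.1.1 f
  rw [fT_eq h.reverse h'.reverse] at e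
  rw [← fR_fT w' h'.1.1 (fR n w f), e]

theorem fR_self {n : ℕ} (w : List ℕ) : ∀ {v : Equiv.Perm (Fin n)}, IsReducedExpr n w v →
    fR n w (dl 1) v = 1 := by
  induction w using List.reverseRecOn with
  | nil => intro v h; have := h.1.2; simp at this; simp [fR, dl, this]
  | append_singleton w i ih =>
    intro v h
    obtain ⟨hd, h'⟩ := h.of_concat
    have := ih h'
    unfold fR at *
    rw [List.foldl_append, List.foldl_cons, List.foldl_nil]
    simp [opR, hd, this]

theorem fR_support {n : ℕ} (w : List ℕ) : ∀ {u v : Equiv.Perm (Fin n)}, IsReducedExpr n w v →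
    fR n w (dl 1) u ≠ 0 → ∃ w', w'.Sublist w ∧ IsReducedExpr n w' u := by
  induction w using List.reverseRecOn with
  | nil =>
    intro u v h hu
    have h1 : u = 1 := by
      by_contra hc; exact hu (by simp [fR, dl, hc])
    have h2 := h.1.2
    simp at h2
    subst h1; subst h2
    exact ⟨[], List.Sublist.refl _, h⟩
  | append_singleton w i ih =>
    intro u v h hu
    obtain ⟨hd, h'⟩ := h.of_concat
    unfold fR at *
    rw [List.foldl_append, List.foldl_cons, List.foldl_nil] at hu
    by_cases hz : List.foldl (fun g i => opR n i g) (dl 1) w (u * s n i) = 0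
    · have hu2 : List.foldl (fun g i => opR n i g) (dl 1) w u ≠ 0 := by
        intro hc; apply hu; simp [opR, hz, hc]
      obtain ⟨x, hx, hx'⟩ := ih h' hu2
      exact ⟨x, hx.trans (List.sublist_append_left _ _), hx'⟩
    · obtain ⟨x, hx, hx'⟩ := ih h' hz
      by_cases hdu : Dc u i
      · exact ⟨x ++ [i], hx.append (List.Sublist.refl _), hx'.concat hdu⟩
      · have hdu' := (Dc_mul_s u hd.1).2 hdu
        have hl := len_of_Dc hdu'
        have hex := hdu'
        rw [← hx'.1.2] at hex
        obtain ⟨y, hy1, hy2, hy3⟩ := exchange x hex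
        rw [mul_s_mul_s] at hl
        have := hx'.2
        refine ⟨y, (hy1.trans hx).trans (List.sublist_append_left _ _), ⟨?_, ?_⟩, by omega⟩
        · exact fun k hk => hx'.1.1 k (hy1.subset hk)
        · rw [hy3, hx'.1.2, mul_s_mul_s]

theorem eq_one_of_no_descent {n : ℕ} {v : Equiv.Perm (Fin n)} (h : ∀ i, ¬ Dc v i) : v = 1 := by
  obtain ⟨w, hw⟩ := exists_reduced v
  rcases List.eq_nil_or_concat w with rfl | ⟨x, i, rfl⟩
  · have := hw.1.2; simpa using this.symm
  · rw [List.concat_eq_append] at hw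
    exact absurd hw.of_concat.1 (h i)

/-- There is exactly one family of `R̃`-polynomials. -/
theorem existsUnique_isRTildeFamily (n : ℕ) : ∃! R, IsRTildeFamily n R := by
  choose wd hwd using fun v : Equiv.Perm (Fin n) => exists_reduced v
  have hstep : ∀ u v i, Dc v i → fR n (wd v) (dl 1) u =
      opR n i (fR n (wd (v * s n i)) (dl 1)) u := by
    intro u v i hd
    rw [fR_eq (hwd v) ((hwd (v * s n i)).concat hd)]
    unfold fR
    rw [List.foldl_append, List.foldl_cons, List.foldl_nil]
  refine ⟨fun u v => fR n (wd v) (dl 1) u, ⟨?_, ?_, ?_, ?_⟩, ?_⟩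
  · intro u v h
    by_contra hc
    apply h
    intro w hw
    apply fR_support w hw
    rw [fR_eq hw (hwd v)]
    exact hc
  · intro v
    exact fR_self _ (hwd v)
  · intro u v i _ hv hu
    rw [isRightDescent_iff] at hu hv
    simp only [hstep u v i hv]
    simp [opR, hu]
  · intro u v i _ hv hu
    rw [isRightDescent_iff] at hu hv
    simp only [hstep u v i hv]
    simp [opR, hu]
  · intro R hR
    have key : ∀ m v, len n v = m → ∀ u, R u v = fR n (wd v) (dl 1) u := by
      intro m
      induction m with
      | zero =>
        intro v hv u
        have h0 : wd v = [] := List.length_eq_zero_iff.1 (by rw [(hwd v).2, hv])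
        have hv1 : v = 1 := by have := (hwd v).1.2; rw [h0] at this; simpa using this.symm
        by_cases hu : u = v
        · subst hu; rw [hR.self, fR_self _ (hwd u)]
        · rw [hR.eq_zero]
          · rw [h0]; simp [fR, dl, ← hv1, hu]
          · intro hle
            obtain ⟨x, hx, hx'⟩ := hle _ (hwd v)
            rw [h0] at hx
            have := List.sublist_nil.1 hx
            subst this
            have := hx'.1.2
            simp at this
            exact hu (by rw [← this, hv1])
      | succ m ih =>
        intro v hv u
        by_cases hle : BruhatLE n u v
        · have hex : ∃ i, Dc v i := by
            by_contra hc
            push Not at hc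
            have := eq_one_of_no_descent hc
            subst this
            have := len_le (n := n) (w := []) (π := 1) ⟨by simp, by simp⟩
            simp at this
            omega
          obtain ⟨i, hi⟩ := hex
          have hl := len_of_Dc hi
          have ih' := ih (v * s n i) (by omega)
          rw [hstep u v i hi]
          by_cases hu : Dc u i
          · rw [hR.of_descent u v i hle (isRightDescent_iff.2 hi) (isRightDescent_iff.2 hu), ih']
            simp [opR, hu]
          · rw [hR.of_not_descent u v i hle (isRightDescent_iff.2 hi)
              (fun h => hu (isRightDescent_iff.1 h)), ih', ih']
            simp [opR, hu]
        · rw [hR.eq_zero u v hle]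
          by_contra hc
          apply hle
          intro w hw
          apply fR_support w hw
          rw [fR_eq hw (hwd v)]
          exact fun h => hc h.symm
    funext u v
    exact key _ v rfl u

/-- The polynomial `R̃_{u,v}(q)`, for `u, v ∈ S_n`. -/
noncomputable def rTilde (n : ℕ) : Equiv.Perm (Fin n) → Equiv.Perm (Fin n) → ℤ[X] :=
  (existsUnique_isRTildeFamily n).choose

theorem isRTildeFamily_rTilde (n : ℕ) : IsRTildeFamily n (rTilde n) :=
  (existsUnique_isRTildeFamily n).choose_spec.1

/-- The permutation `v_n = 3 4 ⋯ n 1 2` (one-line notation), for `n ≥ 2`; in particular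
`v_2 = 1 2` is the identity. -/
def vPerm (n : ℕ) : Equiv.Perm (Fin n) := finRotate n ^ 2

theorem vPerm_apply (n : ℕ) (k : Fin n) : (vPerm n k).val = (k.val + 2) % n := by
  cases n with
  | zero => exact k.elim0
  | succ m =>
    simp [vPerm, pow_two, Fin.val_add, add_assoc]

/-- The word `Ω_n = s_2 s_1 s_3 s_2 ⋯ s_{n-1} s_{n-2}`. -/
def omegaWord (n : ℕ) : List ℕ := (List.range (n - 2)).flatMap fun j => [j + 2, j + 1]

/-- `d(ω)`: the number of `1 ≤ t < k` with `i_t - i_{t+1} = 1`, for `ω = s_{i_1} ⋯ s_{i_k}`. -/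
def dStat (ω : List ℕ) : ℕ := (ω.zip ω.tail).countP fun p => p.1 = p.2 + 1

/-- `h(ω) = n - ℓ(ω) + d(ω)`. -/
def hStat (n : ℕ) (ω : List ℕ) : ℕ := n + dStat ω - ω.length

end RTilde

namespace RTilde

open Polynomial

/-! The function `u ↦ R̃_{u,v}` arises from the indicator of `e` by applying the operators `opR`
along any reduced word of `v` (`rTilde_eq_fR`), and `Ω_n` is a reduced word of `v_n`
(`isReducedExpr_omegaWord`). The word grows by blocks `s_{m+2} s_{m+1}`, and before such a block the
function `f` is supported on the parabolic subgroup `S_{m+2}`. A subword of `Ω_n` takes none, one or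
both letters of each block.

The values `f(u)` alone do not satisfy a closed recursion, but the pairs `(p, r)` do, where `p =
f(u)` and `r` is the value at `u` after applying `s_{m+1}` once more. Taking no letter of the block
turns `(p, r)` into `(q r, q p + q² r)`; one letter gives `(q p, q r)`; both letters leave `(p, r)`
unchanged. These are the lemmas of section `Step`; the braid relation enters through
`opR_opR_opR_apply_mul_mul`.

Since the "no letter" rule is linear in the pair, only the numbers `z`, `a`, `d` of blocks of the
three kinds matter (`fR_omegaWord`). The value is `q^a` times the value at `e` for the word with `z`
blocks, which is `R̃_{e,v_{z+2}}`. Counting letters and blocks gives `ℓ = a + 2d` and `n - 2 = a + d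
+ z`, hence `a = ℓ - 2d` and `z + 2 = h`. -/

/-- Any reduced expression of `v` computes `R̃_{·,v}`. -/
theorem rTilde_eq_fR {n : ℕ} {w : List ℕ} {v : Equiv.Perm (Fin n)} (hw : IsReducedExpr n w v)
    (u : Equiv.Perm (Fin n)) : rTilde n u v = fR n w (dl 1) u := by
  choose wd hwd using fun v : Equiv.Perm (Fin n) => exists_reduced v
  have hstep : ∀ u v i, Dc v i → fR n (wd v) (dl 1) u =
      opR n i (fR n (wd (v * s n i)) (dl 1)) u := by
    intro u v i hd
    rw [fR_eq (hwd v) ((hwd (v * s n i)).concat hd)]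
    unfold fR
    rw [List.foldl_append, List.foldl_cons, List.foldl_nil]
  have hfam : IsRTildeFamily n fun u v => fR n (wd v) (dl 1) u := by
    refine ⟨fun u v h => ?_, fun v => fR_self _ (hwd v), fun u v i _ hv hu => ?_,
      fun u v i _ hv hu => ?_⟩
    · by_contra hc
      refine h fun x hx => fR_support x hx ?_
      rw [fR_eq hx (hwd v)]
      exact hc
    · rw [isRightDescent_iff] at hu hv
      simp only [hstep u v i hv]
      simp [opR, hu]
    · rw [isRightDescent_iff] at hu hv
      simp only [hstep u v i hv]
      simp [opR, hu]
  rw [(existsUnique_isRTildeFamily n).unique (isRTildeFamily_rTilde n) hfam, fR_eq hw (hwd v)]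

/-- Lets `Ω` be processed one block at a time. -/
theorem fR_append (n : ℕ) (w x : List ℕ) (f : Equiv.Perm (Fin n) → ℤ[X]) :
    fR n (w ++ x) f = fR n x (fR n w f) := by
  unfold fR
  rw [List.foldl_append]

theorem isReducedExpr_nil (n : ℕ) : IsReducedExpr n [] 1 := by
  have h : IsExpr n [] 1 := ⟨by simp, by simp⟩
  exact ⟨h, (Nat.le_zero.1 (len_le h)).symm⟩

/-! ### Simple transpositions on 0-based positions -/

theorem s_apply_left {n i : ℕ} (hi : i + 1 < n) :
    s n (i + 1) ⟨i, by omega⟩ = ⟨i + 1, hi⟩ := by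
  simp [s, hi]

theorem s_apply_right {n i : ℕ} (hi : i + 1 < n) :
    s n (i + 1) ⟨i + 1, hi⟩ = ⟨i, by omega⟩ := by
  simp [s, hi]

theorem s_apply_of_ne {n i : ℕ} {x : Fin n} (h1 : x.val ≠ i) (h2 : x.val ≠ i + 1) :
    s n (i + 1) x = x := by
  unfold s
  split_ifs
  · exact Equiv.swap_apply_of_ne_of_ne (by simpa [Fin.ext_iff] using h1)
      (by simpa [Fin.ext_iff] using h2)
  · rfl

theorem s_braid {n i : ℕ} (hi : i + 2 < n) :
    s n (i + 2) * s n (i + 1) * s n (i + 2) = s n (i + 1) * s n (i + 2) * s n (i + 1) := by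
  have h1 := s_apply_left (n := n) (i := i) (by omega)
  have h2 := s_apply_right (n := n) (i := i) (by omega)
  have h3 := s_apply_left (n := n) (i := i + 1) (by omega)
  have h4 := s_apply_right (n := n) (i := i + 1) (by omega)
  have h5 : s n (i + 2) ⟨i, by omega⟩ = ⟨i, by omega⟩ :=
    s_apply_of_ne (by simp) (by simp; omega)
  have h6 : s n (i + 1) ⟨i + 2, hi⟩ = ⟨i + 2, hi⟩ := s_apply_of_ne (by simp) (by simp)
  have e : i + 1 + 1 = i + 2 := rfl
  simp only [e] at h3 h4
  ext x
  by_cases a : x.val = i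
  · have hx : x = ⟨i, by omega⟩ := Fin.ext a
    rw [hx]
    simp [h1, h3, h5, h6]
  by_cases b : x.val = i + 1
  · have hx : x = ⟨i + 1, by omega⟩ := Fin.ext b
    rw [hx]
    simp [h1, h2, h3, h4, h5, h6]
  by_cases c : x.val = i + 2
  · have hx : x = ⟨i + 2, by omega⟩ := Fin.ext c
    rw [hx]
    simp [h2, h4, h5, h6]
  have h7 : s n (i + 1) x = x := s_apply_of_ne a b
  have h8 : s n (i + 2) x = x := s_apply_of_ne b c
  simp [h7, h8]

theorem Dc_succ_iff {n i : ℕ} (hi : i + 1 < n) (u : Equiv.Perm (Fin n)) :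
    Dc u (i + 1) ↔ u ⟨i + 1, hi⟩ < u ⟨i, by omega⟩ :=
  ⟨fun h => h.2, fun h => ⟨⟨by omega, hi⟩, h⟩⟩

/-! ### Parabolic subgroups and supports -/

/-- The parabolic subgroup `S_k` of `S_n`, fixing all letters after the first `k`. -/
def parabolic (n k : ℕ) : Subgroup (Equiv.Perm (Fin n)) where
  carrier := {u | ∀ x : Fin n, k ≤ x.val → u x = x}
  one_mem' := fun _ _ => rfl
  mul_mem' := fun {u v} hu hv x hx => by rw [Equiv.Perm.mul_apply, hv x hx, hu x hx]
  inv_mem' := fun {u} hu x hx => by rw [Equiv.Perm.inv_eq_iff_eq, hu x hx]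

theorem apply_lt_of_mem_parabolic {n k : ℕ} {u : Equiv.Perm (Fin n)} (hu : u ∈ parabolic n k)
    {x : Fin n} (hx : x.val < k) : (u x).val < k := by
  by_contra h
  have := u.injective (hu (u x) (by omega))
  rw [this] at h
  exact h hx

/-- `s_i` moves only the 0-based positions `i - 1` and `i`, both below `k`. -/
theorem s_mem_parabolic {n i k : ℕ} (h : i < k) : s n i ∈ parabolic n k := by
  cases i with
  | zero => simp [s]
  | succ i => exact fun x hx => s_apply_of_ne (by omega) (by omega)

theorem prod_mem_parabolic {n k : ℕ} {w : List ℕ} (h : ∀ i ∈ w, i < k) :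
    (w.map (s n)).prod ∈ parabolic n k := by
  refine Subgroup.list_prod_mem _ fun x hx => ?_
  obtain ⟨i, hi, rfl⟩ := List.mem_map.1 hx
  exact s_mem_parabolic (h i hi)

theorem s_notMem_parabolic {n i : ℕ} (hi : i + 1 < n) : s n (i + 1) ∉ parabolic n (i + 1) := by
  intro h
  have := h ⟨i + 1, hi⟩ le_rfl
  rw [s_apply_right hi] at this
  simp at this

theorem not_Dc_of_mem_parabolic {n i : ℕ} {u : Equiv.Perm (Fin n)}
    (hu : u ∈ parabolic n (i + 1)) : ¬ Dc u (i + 1) := by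
  rintro ⟨⟨_, hi⟩, h⟩
  rw [hu ⟨i + 1, hi⟩ le_rfl, Fin.lt_def] at h
  have := apply_lt_of_mem_parabolic hu (x := ⟨i, by omega⟩) (by simp)
  simp at h this
  omega

/-- Right multiplication by an element of the subgroup preserves its complement, and `opR` combines
only values at `u` and `u s_i`. -/
theorem opR_eq_zero {n k i : ℕ} {f : Equiv.Perm (Fin n) → ℤ[X]}
    (hf : ∀ u ∉ parabolic n k, f u = 0) (hi : i < k) :
    ∀ u ∉ parabolic n k, opR n i f u = 0 := by
  intro u hu
  have h : u * s n i ∉ parabolic n k := fun h =>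
    hu ((Subgroup.mul_mem_cancel_right _ (s_mem_parabolic hi)).1 h)
  simp [opR, hf _ h, hf _ hu]

theorem fR_eq_zero {n k : ℕ} {w : List ℕ} (hw : ∀ i ∈ w, i < k) :
    ∀ u ∉ parabolic n k, fR n w (dl 1) u = 0 := by
  induction w using List.reverseRecOn with
  | nil =>
    intro u hu
    have : u ≠ 1 := fun h => hu (h ▸ one_mem _)
    simp [fR, dl, this]
  | append_singleton w i ih =>
    rw [fR_append]
    exact opR_eq_zero (ih fun j hj => hw j (by simp [hj])) (hw i (by simp))

section Step

/-! Effect of `opR` along `s_{i+2} s_{i+1}` on a function supported on the parabolic subgroup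
`S_{i+2}`. -/

variable {n i : ℕ} {f : Equiv.Perm (Fin n) → ℤ[X]} {u : Equiv.Perm (Fin n)}

theorem mul_s_notMem (hi : i + 1 < n) (hu : u ∈ parabolic n (i + 1)) :
    u * s n (i + 1) ∉ parabolic n (i + 1) := fun h =>
  s_notMem_parabolic hi ((Subgroup.mul_mem_cancel_left _ hu).1 h)

theorem opR_apply_mul {i : ℕ} (hi : 1 ≤ i ∧ i < n) (hu : ¬ Dc u i) :
    opR n i f (u * s n i) = f u := by
  simp [opR, (Dc_mul_s u hi).2 hu, mul_s_mul_s]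

theorem opR_of_Dc {i : ℕ} (hu : Dc u i) : opR n i f u = f (u * s n i) := by
  simp [opR, hu]

theorem opR_of_not_Dc {i : ℕ} (hu : ¬ Dc u i) :
    opR n i f u = f (u * s n i) + X * f u := by
  simp [opR, hu]

theorem opR_new (hi : i + 1 < n) (hf : ∀ x ∉ parabolic n (i + 1), f x = 0)
    (hu : u ∈ parabolic n (i + 1)) : opR n (i + 1) f u = X * f u := by
  rw [opR_of_not_Dc (not_Dc_of_mem_parabolic hu), hf _ (mul_s_notMem hi hu), zero_add]

theorem opR_new_mul (hi : i + 1 < n) (hu : u ∈ parabolic n (i + 1)) :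
    opR n (i + 1) f (u * s n (i + 1)) = f u :=
  opR_apply_mul ⟨by omega, hi⟩ (not_Dc_of_mem_parabolic hu)

/-- On `S_{i+2}` the new letter acts as multiplication by `X`, because `u s_{i+2}` lies outside the
support; `s_{i+1}` preserves `S_{i+2}`, so this factor can be pulled out. -/
theorem opR_opR_apply (hi : i + 2 < n) (hf : ∀ x ∉ parabolic n (i + 2), f x = 0)
    (hu : u ∈ parabolic n (i + 2)) :
    opR n (i + 1) (opR n (i + 2) f) u = X * opR n (i + 1) f u := by
  have h : u * s n (i + 1) ∈ parabolic n (i + 2) := mul_mem hu (s_mem_parabolic (by omega))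
  by_cases hd : Dc u (i + 1)
  · rw [opR_of_Dc hd, opR_of_Dc hd, opR_new hi hf h]
  · rw [opR_of_not_Dc hd, opR_of_not_Dc hd, opR_new hi hf h, opR_new hi hf hu]
    ring

/-- After `s_{i+2}`, the 0-based position `i + 1` carries the value `i + 2`, which exceeds every
value `u` takes on the first `i + 2` positions. -/
theorem not_Dc_mul_new (hi : i + 2 < n) (hu : u ∈ parabolic n (i + 2)) :
    ¬ Dc (u * s n (i + 2)) (i + 1) := by
  have h5 : s n (i + 2) ⟨i, by omega⟩ = ⟨i, by omega⟩ :=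
    s_apply_of_ne (by simp) (by simp; omega)
  have h3 : s n (i + 2) ⟨i + 1, by omega⟩ = ⟨i + 2, by omega⟩ :=
    s_apply_left (n := n) (i := i + 1) (by omega)
  rw [Dc_succ_iff (by omega), Equiv.Perm.mul_apply, Equiv.Perm.mul_apply, h5, h3,
    hu ⟨i + 2, hi⟩ le_rfl, Fin.lt_def]
  have := apply_lt_of_mem_parabolic hu (x := ⟨i, by omega⟩) (by simp)
  simp
  omega

theorem opR_opR_apply_mul (hi : i + 2 < n) (hf : ∀ x ∉ parabolic n (i + 2), f x = 0)
    (hu : u ∈ parabolic n (i + 2)) :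
    opR n (i + 1) (opR n (i + 2) f) (u * s n (i + 2)) = X * f u := by
  have ht : s n (i + 1) ∈ parabolic n (i + 2) := s_mem_parabolic (by omega)
  have h1 : u * s n (i + 2) * s n (i + 1) ∉ parabolic n (i + 2) := fun h =>
    mul_s_notMem hi hu ((Subgroup.mul_mem_cancel_right _ ht).1 h)
  have h2 : u * s n (i + 2) * s n (i + 1) * s n (i + 2) ∉ parabolic n (i + 2) := by
    have : u * s n (i + 2) * s n (i + 1) * s n (i + 2) =
        u * s n (i + 1) * s n (i + 2) * s n (i + 1) := by
      simpa [mul_assoc] using congrArg (u * ·) (s_braid hi)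
    -- By the braid relation the element is `u s_{i+1}`, still in the subgroup, times `s_{i+2}`,
    -- which leaves it, times `s_{i+1}`, which cannot lead back.
    rw [this]
    exact fun h => mul_s_notMem hi (mul_mem hu ht) ((Subgroup.mul_mem_cancel_right _ ht).1 h)
  rw [opR_of_not_Dc (not_Dc_mul_new hi hu), opR_new_mul hi hu]
  simp [opR, hf _ h1, hf _ h2]

theorem opR_opR_apply_mul_mul (hi : i + 2 < n) (hu : u ∈ parabolic n (i + 2)) :
    opR n (i + 1) (opR n (i + 2) f) (u * s n (i + 2) * s n (i + 1)) = f u := by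
  rw [opR_apply_mul ⟨by omega, by omega⟩ (not_Dc_mul_new hi hu), opR_new_mul hi hu]

theorem opR_opR_opR_apply (hi : i + 2 < n) (hf : ∀ x ∉ parabolic n (i + 2), f x = 0)
    (hu : u ∈ parabolic n (i + 2)) :
    opR n (i + 2) (opR n (i + 1) (opR n (i + 2) f)) u =
      X * f u + X ^ 2 * opR n (i + 1) f u := by
  rw [opR_of_not_Dc (not_Dc_of_mem_parabolic hu), opR_opR_apply_mul hi hf hu,
    opR_opR_apply hi hf hu]
  ring

theorem opR_opR_opR_apply_mul (hi : i + 2 < n) (hf : ∀ x ∉ parabolic n (i + 2), f x = 0)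
    (hu : u ∈ parabolic n (i + 2)) :
    opR n (i + 2) (opR n (i + 1) (opR n (i + 2) f)) (u * s n (i + 2)) =
      X * opR n (i + 1) f u := by
  rw [opR_new_mul hi hu, opR_opR_apply hi hf hu]

/-- Taking the old letter `s_{i+1}` at an ascent replaces `f(u s) + X f(u)` by the same expression,
now read as the value at `u` of `opR` applied to `f`. -/
theorem opR_opR_opR_apply_mul_old (hi : i + 2 < n) (hf : ∀ x ∉ parabolic n (i + 2), f x = 0)
    (hu : u ∈ parabolic n (i + 2)) (hd : ¬ Dc u (i + 1)) :
    opR n (i + 2) (opR n (i + 1) (opR n (i + 2) f)) (u * s n (i + 1)) =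
      X * opR n (i + 1) f u := by
  rw [opR_opR_opR_apply hi hf (mul_mem hu (s_mem_parabolic (by omega))),
    opR_apply_mul ⟨by omega, by omega⟩ hd, opR_of_not_Dc hd]
  ring

/-- The factor `s_{i+2} s_{i+1}` shifts the entries of `u` at 0-based positions `i`, `i + 1` to `i +
1`, `i + 2`, keeping their order. -/
theorem Dc_mul_mul_iff (hi : i + 2 < n) (u : Equiv.Perm (Fin n)) :
    Dc (u * s n (i + 2) * s n (i + 1)) (i + 2) ↔ Dc u (i + 1) := by
  have h1 := s_apply_right (n := n) (i := i) (by omega)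
  have h4 : s n (i + 2) ⟨i + 2, hi⟩ = ⟨i + 1, by omega⟩ :=
    s_apply_right (n := n) (i := i + 1) (by omega)
  have h5 : s n (i + 2) ⟨i, by omega⟩ = ⟨i, by omega⟩ :=
    s_apply_of_ne (by simp) (by simp; omega)
  have h6 : s n (i + 1) ⟨i + 2, hi⟩ = ⟨i + 2, hi⟩ := s_apply_of_ne (by simp) (by simp)
  rw [Dc_succ_iff (i := i + 1) hi, Dc_succ_iff (i := i) (by omega)]
  simp only [Equiv.Perm.mul_apply, add_assoc, Nat.reduceAdd, h1, h4, h5, h6]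

/-- Since `s_{i+2} s_{i+1} s_{i+2} = s_{i+1} s_{i+2} s_{i+1}`, the operator for `s_{i+2}` acts on
the coset `S_{i+2} s_{i+2} s_{i+1}` as that for `s_{i+1}` acts on `S_{i+2}`, descents included. -/
theorem opR_opR_opR_apply_mul_mul (hi : i + 2 < n) (hu : u ∈ parabolic n (i + 2)) :
    opR n (i + 2) (opR n (i + 1) (opR n (i + 2) f)) (u * s n (i + 2) * s n (i + 1)) =
      opR n (i + 1) f u := by
  have hb : u * s n (i + 2) * s n (i + 1) * s n (i + 2) =
      u * s n (i + 1) * s n (i + 2) * s n (i + 1) := by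
    simpa [mul_assoc] using congrArg (u * ·) (s_braid hi)
  have ht : u * s n (i + 1) ∈ parabolic n (i + 2) := mul_mem hu (s_mem_parabolic (by omega))
  by_cases hd : Dc u (i + 1)
  · rw [opR_of_Dc ((Dc_mul_mul_iff hi u).2 hd), hb, opR_opR_apply_mul_mul hi ht, opR_of_Dc hd]
  · rw [opR_of_not_Dc (mt (Dc_mul_mul_iff hi u).1 hd), hb, opR_opR_apply_mul_mul hi ht,
      opR_opR_apply_mul_mul hi hu, opR_of_not_Dc hd]

end Step

/-! ### `Ω_n` is a reduced word of `v_n` -/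

theorem omegaWord_succ (m : ℕ) : omegaWord (m + 3) = omegaWord (m + 2) ++ [m + 2, m + 1] := by
  simp [omegaWord, List.range_succ, show m + 3 - 2 = m + 1 by omega]

theorem lt_of_mem_omegaWord {m i : ℕ} (h : i ∈ omegaWord (m + 2)) : i < m + 2 := by
  simp [omegaWord] at h
  omega

/-- Each block `s_{m+2} s_{m+1}` acts first, as the 3-cycle `m ↦ m + 2 ↦ m + 1 ↦ m` on 0-based
positions. -/
theorem omegaWord_prod_apply {n m : ℕ} (hm : m + 2 ≤ n) (x : Fin n) :
    (((omegaWord (m + 2)).map (s n)).prod x).val =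
      if x.val < m then x.val + 2 else if x.val < m + 2 then x.val - m else x.val := by
  induction m generalizing x with
  | zero => simp [omegaWord]
  | succ m ih =>
    have ih := ih (by omega)
    have h1 := s_apply_left (n := n) (i := m) (by omega)
    have h2 := s_apply_right (n := n) (i := m) (by omega)
    have h3 : s n (m + 2) ⟨m + 1, by omega⟩ = ⟨m + 2, by omega⟩ :=
      s_apply_left (n := n) (i := m + 1) (by omega)
    have h4 : s n (m + 2) ⟨m + 2, by omega⟩ = ⟨m + 1, by omega⟩ :=
      s_apply_right (n := n) (i := m + 1) (by omega)
    have h5 : s n (m + 2) ⟨m, by omega⟩ = ⟨m, by omega⟩ :=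
      s_apply_of_ne (by simp) (by simp; omega)
    have h6 : s n (m + 1) ⟨m + 2, by omega⟩ = ⟨m + 2, by omega⟩ :=
      s_apply_of_ne (by simp) (by simp)
    rw [show m + 1 + 2 = m + 3 from rfl, omegaWord_succ, List.map_append, List.prod_append,
      Equiv.Perm.mul_apply, ih]
    simp only [List.map_cons, List.map_nil, List.prod_cons, List.prod_nil, mul_one,
      Equiv.Perm.mul_apply]
    by_cases a : x.val = m
    · have hx : x = ⟨m, by omega⟩ := Fin.ext a
      rw [hx]
      simp [h1, h3]
    by_cases b : x.val = m + 1
    · have hx : x = ⟨m + 1, by omega⟩ := Fin.ext b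
      rw [hx]
      simp [h2, h5]
    by_cases c : x.val = m + 2
    · have hx : x = ⟨m + 2, by omega⟩ := Fin.ext c
      rw [hx]
      simp [h6, h4]
    have h7 : s n (m + 1) x = x := s_apply_of_ne a b
    have h8 : s n (m + 2) x = x := s_apply_of_ne b c
    rw [h7, h8]
    split_ifs <;> omega

/-- Both letters of each block raise the length: the first is new to the parabolic subgroup, and
`not_Dc_mul_new` covers the second. -/
theorem isReducedExpr_omegaWord_prod {n m : ℕ} (hm : m + 2 ≤ n) :
    IsReducedExpr n (omegaWord (m + 2)) ((omegaWord (m + 2)).map (s n)).prod := by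
  induction m with
  | zero => exact isReducedExpr_nil n
  | succ m ih =>
    have ih := ih (by omega)
    have hmem := prod_mem_parabolic (n := n) fun i => lt_of_mem_omegaWord (m := m) (i := i)
    have hp : ((omegaWord (m + 3)).map (s n)).prod =
        ((omegaWord (m + 2)).map (s n)).prod * s n (m + 2) * s n (m + 1) := by
      simp [omegaWord_succ, mul_assoc]
    rw [show m + 1 + 2 = m + 3 from rfl, hp, omegaWord_succ,
      show [m + 2, m + 1] = [m + 2] ++ [m + 1] from rfl, ← List.append_assoc]
    refine IsReducedExpr.concat (IsReducedExpr.concat ?_ ?_)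
      ((Dc_mul_s _ ⟨by omega, by omega⟩).2 (not_Dc_mul_new (by omega) hmem))
    · simpa only [mul_s_mul_s] using ih
    · rw [mul_s_mul_s]
      exact (Dc_mul_s _ ⟨by omega, by omega⟩).2 (not_Dc_of_mem_parabolic (i := m + 1) hmem)

theorem isReducedExpr_omegaWord {n : ℕ} (hn : 2 ≤ n) :
    IsReducedExpr n (omegaWord n) (vPerm n) := by
  obtain ⟨m, rfl⟩ := Nat.exists_eq_add_of_le' hn
  have h : ((omegaWord (m + 2)).map (s (m + 2))).prod = vPerm (m + 2) := by
    ext x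
    rw [omegaWord_prod_apply le_rfl, vPerm_apply]
    have := x.isLt
    split_ifs
    · rw [Nat.mod_eq_of_lt (by omega)]
    · rw [Nat.mod_eq_sub_mod (by omega), Nat.mod_eq_of_lt (by omega)]
      omega
  rw [← h]
  exact isReducedExpr_omegaWord_prod le_rfl

/-! ### The statistic `d` under appending part of a block -/

theorem dStat_cons_cons (a b : ℕ) (w : List ℕ) :
    dStat (a :: b :: w) = dStat (b :: w) + if a = b + 1 then 1 else 0 := by
  simp [dStat, List.countP_cons]

/-- A largest letter at the end cannot be reached by a drop of one. Hence `d` counts exactly the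
blocks used in full. -/
theorem dStat_append_singleton {w : List ℕ} {a : ℕ} (h : ∀ i ∈ w, i ≤ a) :
    dStat (w ++ [a]) = dStat w := by
  induction w with
  | nil => rfl
  | cons b w ih =>
    cases w with
    | nil =>
      have := h b (by simp)
      simp [dStat]
      omega
    | cons c w =>
      have := ih fun i hi => h i (by simp at hi ⊢; tauto)
      simp only [List.cons_append, dStat_cons_cons] at this ⊢
      rw [this]

theorem dStat_append_pair (w : List ℕ) (a : ℕ) :
    dStat (w ++ [a + 1, a]) = dStat (w ++ [a + 1]) + 1 := by
  induction w with
  | nil => simp [dStat]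
  | cons b w ih =>
    cases w with
    | nil => simp [dStat, List.countP_cons]; omega
    | cons c w =>
      simp only [List.cons_append, dStat_cons_cons] at ih ⊢
      omega

/-! ### The recursion on pairs -/

/-- The values at `e` of the functions that `opR` yields from `dl 1` along the words `Ω_{z+2}` and
`Ω_{z+2} s_{z+1}`. -/
noncomputable def fibPair : ℕ → ℤ[X] × ℤ[X]
  | 0 => (1, X)
  | z + 1 => (X * (fibPair z).2, X * (fibPair z).1 + X ^ 2 * (fibPair z).2)

/-- The second value strengthens the claim enough for the induction on the number `m` of blocks. The
ambient `n` stays fixed, so all stages live in one group. The witnesses `a` and `z` count the blocks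
contributing one letter and none. -/
theorem fR_omegaWord {n m : ℕ} (hm : m + 2 ≤ n) {ω : List ℕ} {σ : Equiv.Perm (Fin n)}
    (hω : IsReducedExpr n ω σ) (hsub : ω.Sublist (omegaWord (m + 2))) :
    ∃ a z, ω.length = a + 2 * dStat ω ∧ m = a + dStat ω + z ∧
      fR n (omegaWord (m + 2)) (dl 1) σ = X ^ a * (fibPair z).1 ∧
      opR n (m + 1) (fR n (omegaWord (m + 2)) (dl 1)) σ = X ^ a * (fibPair z).2 := by
  induction m generalizing ω σ with
  | zero =>
    obtain rfl : ω = [] := by simpa [omegaWord] using hsub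
    obtain rfl : σ = 1 := by simpa using hω.1.2.symm
    refine ⟨0, 0, by simp [dStat], by simp [dStat], ?_, ?_⟩
    · simp [omegaWord, fR, dl, fibPair]
    · rw [opR_of_not_Dc (not_Dc_one _)]
      -- The term at `e s_1` vanishes, leaving the initial pair `(1, X)`.
      have h : s n 1 ≠ 1 := fun h => s_notMem_parabolic (n := n) (i := 0) (by omega)
        (by rw [h]; exact one_mem _)
      simp [omegaWord, fR, dl, fibPair, h]
  | succ m ih =>
    have hi : m + 2 < n := by omega
    have hf := fR_eq_zero (n := n) fun i => lt_of_mem_omegaWord (m := m) (i := i)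
    have hfR : fR n (omegaWord (m + 3)) (dl 1) =
        opR n (m + 1) (opR n (m + 2) (fR n (omegaWord (m + 2)) (dl 1))) := by
      rw [omegaWord_succ, fR_append]; rfl
    rw [show m + 1 + 2 = m + 3 from rfl] at hsub ⊢
    rw [show m + 1 + 1 = m + 2 from rfl, hfR]
    rw [omegaWord_succ, List.sublist_append_iff] at hsub
    obtain ⟨w, x, rfl, hw, hx⟩ := hsub
    have hlt : ∀ i ∈ w, i < m + 2 := fun i hi => lt_of_mem_omegaWord (hw.subset hi)
    have hmem : ∀ {u}, IsReducedExpr n w u → u ∈ parabolic n (m + 2) := fun h => by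
      rw [← h.1.2]; exact prod_mem_parabolic hlt
    have d1 : dStat (w ++ [m + 1]) = dStat w :=
      dStat_append_singleton fun i hi => by have := hlt i hi; omega
    have d2 : dStat (w ++ [m + 2]) = dStat w :=
      dStat_append_singleton fun i hi => by have := hlt i hi; omega
    have d3 : dStat (w ++ [m + 2, m + 1]) = dStat w + 1 := by rw [dStat_append_pair, d2]
    have hcases : x = [] ∨ x = [m + 1] ∨ x = [m + 2] ∨ x = [m + 2, m + 1] := by
      rcases List.sublist_cons_iff.1 hx with h | ⟨r, rfl, h⟩ <;>
      rcases List.sublist_cons_iff.1 h with h | ⟨r, rfl, h⟩ <;> simp_all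
    generalize fR n (omegaWord (m + 2)) (dl 1) = f at ih hf
    rcases hcases with rfl | rfl | rfl | rfl
    -- No letter of the new block: `z` grows, by the recursion defining `fibPair`.
    · rw [List.append_nil] at hω ⊢
      obtain ⟨a, z, e1, e2, e3, e4⟩ := ih (by omega) hω hw
      refine ⟨a, z + 1, e1, by omega, ?_, ?_⟩
      · rw [opR_opR_apply hi hf (hmem hω), e4, fibPair]
        ring
      · rw [opR_opR_opR_apply hi hf (hmem hω), e3, e4, fibPair]
        ring
    · obtain ⟨hd, hω'⟩ := hω.of_concat
      obtain ⟨a, z, e1, e2, e3, e4⟩ := ih (by omega) hω' hw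
      have hu := hmem hω'
      rw [← mul_s_mul_s σ (m + 1)]
      -- Reducedness of the word makes the old letter an ascent from `u`; membership in the
      -- parabolic subgroup would not give this.
      have hd' : ¬ Dc (σ * s n (m + 1)) (m + 1) := by
        rw [Dc_mul_s _ hd.1]; exact not_not_intro hd
      refine ⟨a + 1, z, by simp [d1]; omega, by omega, ?_, ?_⟩
      · rw [opR_opR_apply hi hf (mul_mem hu (s_mem_parabolic (by omega))),
          opR_apply_mul hd.1 hd', e3]
        ring
      · rw [opR_opR_opR_apply_mul_old hi hf hu hd', e4]
        ring
    · obtain ⟨hd, hω'⟩ := hω.of_concat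
      obtain ⟨a, z, e1, e2, e3, e4⟩ := ih (by omega) hω' hw
      have hu := hmem hω'
      rw [← mul_s_mul_s σ (m + 2)]
      refine ⟨a + 1, z, by simp [d2]; omega, by omega, ?_, ?_⟩
      · rw [opR_opR_apply_mul hi hf hu, e3]
        ring
      · rw [opR_opR_opR_apply_mul hi hf hu, e4]
        ring
    · rw [show w ++ [m + 2, m + 1] = (w ++ [m + 2]) ++ [m + 1] by simp] at hω
      obtain ⟨-, hω'⟩ := hω.of_concat
      obtain ⟨-, hω''⟩ := hω'.of_concat
      obtain ⟨a, z, e1, e2, e3, e4⟩ := ih (by omega) hω'' hw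
      have hu := hmem hω''
      rw [← mul_s_mul_s σ (m + 1), ← mul_s_mul_s (σ * s n (m + 1)) (m + 2)]
      -- Both letters: the length grows by two and `d` by one, so `a` and `z` stay.
      refine ⟨a, z, by simp [d3]; omega, by omega, ?_, ?_⟩
      · rw [opR_opR_apply_mul_mul hi hu, e3]
      · rw [opR_opR_opR_apply_mul_mul hi hu, e4]

/-- The empty subword takes no letter of any of the `z` blocks. -/
theorem rTilde_one_vPerm (z : ℕ) : rTilde (z + 2) 1 (vPerm (z + 2)) = (fibPair z).1 := by
  rw [rTilde_eq_fR (isReducedExpr_omegaWord (by omega))]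
  obtain ⟨a, z', e1, e2, e3, -⟩ :=
    fR_omegaWord (le_refl (z + 2)) (isReducedExpr_nil _) (List.nil_sublist _)
  simp [dStat] at e1 e2
  obtain rfl : a = 0 := by omega
  obtain rfl : z = z' := by omega
  simpa using e3

end RTilde

theorem theorem2p2 (n : ℕ) (hn : 3 ≤ n) (σ : Equiv.Perm (Fin n))
    (hσ : RTilde.BruhatLE n σ (RTilde.vPerm n)) (ω : List ℕ)
    (hω : RTilde.IsReducedExpr n ω σ) (hsub : ω.Sublist (RTilde.omegaWord n)) :
    2 * RTilde.dStat ω ≤ ω.length ∧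
    ω.length + 2 ≤ n + RTilde.dStat ω ∧
    RTilde.rTilde n σ (RTilde.vPerm n) =
      (Polynomial.X : Polynomial ℤ) ^ (ω.length - 2 * RTilde.dStat ω) *
        RTilde.rTilde (RTilde.hStat n ω) 1 (RTilde.vPerm (RTilde.hStat n ω)) := by
  rw [RTilde.rTilde_eq_fR (RTilde.isReducedExpr_omegaWord (by omega))]
  obtain ⟨m, rfl⟩ := Nat.exists_eq_add_of_le' (show 2 ≤ n by omega)
  obtain ⟨a, z, e1, e2, e3, -⟩ := RTilde.fR_omegaWord le_rfl hω hsub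
  -- `(m + 2) + d - (a + 2d)` with `m = a + d + z`.
  have hh : RTilde.hStat (m + 2) ω = z + 2 := by
    unfold RTilde.hStat
    omega
  refine ⟨by omega, by omega, ?_⟩
  rw [hh, RTilde.rTilde_one_vPerm, e3]
  congr 2
  omega
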